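/- Let $\mathbb F_q$ be a finite field, let $1\le k\le n$ be integers and let $0\le\epsilon<1$. A source generates at each time $m=0,1,2,\dots$ a message $u_m\in\mathbb F_q^k$, and a $q$-ary memoryless erasure channel with erasure probability $\epsilon$ and without feedback is used once at each time $0,1,2,\dots$ (so $\lambda=\mu=1$); received symbols arrive without delay. For $l=0,1,2,\dots$, packet $l$ carries the message $u_{ln}$ generated at time $ln$ (all other messages are dropped): it is encoded as $z=u_{ln}^{T}G_l\in\mathbb F_q^n$ with a $k\times n$ generator matrix $G_l$ known to the receiver, and $z_1,\dots,z_n$ are sent at the times $ln,\dots,ln+n-1$. The columns of all the matrices $G_l$ are independent and uniformly distributed on $\mathbb F_q^k\setminus\{0\}$, and are independent of the erasures. The receiver decodes packet $l$ as soon as the symbols of this packet that were not erased contain $k$ linearly independent ones (that is, the corresponding columns of $G_l$ are linearly independent); if this does not happen within the $n$ channel uses, the packet is lost. The instantaneous age is $\Delta(t)=t-U(t)$, where $U(t)$ is the generation time of the freshest message decoded by time $t$; before the first decoding $U(t)=-a_0$ for a fixed initial age $a_0\ge0$. Consider an unlimited sequence of channel uses for one packet, with i.i.d. uniform nonzero columns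 and independent erasures of probability $\epsilon$, and let $B$ be the number of channel uses needed to receive $k$ linearly independent symbols. Let $\epsilon_p=\mathbb P(B>n)$ be the packet erasure probability, and let $T$ be distributed as $B$ conditioned on $B\le n$. Then, almost surely, the average age exists and $$\lim_{\tau\to\infty}\frac1\tau\int_0^\tau\Delta(t)\,\mathrm dt=\mathbb E(T)-1+\frac{n(1+\epsilon_p)}{2(1-\epsilon_p)}.$$ -/

import Mathlib

open MeasureTheory ProbabilityTheory Filter Topology
open scoped ENNReal Matrix

namespace RandomLinearScheme

noncomputable section

/-- The coded symbols in the positions `R` contain `k` linearly independent ones: some `k` of the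
generator columns with index in `R` are linearly independent. -/
def Decodable {F : Type*} [Field F] {k : ℕ} {ι : Type*} (col : ι → Fin k → F) (R : Set ι) : Prop :=
  ∃ s : Fin k → ι, (∀ j, s j ∈ R) ∧ LinearIndependent F (fun j => col (s j))

/-! ### Encoder, channel, decoder for one packet -/

/-- The linear encoder `z = uᵀ G`. -/
def encode {F : Type*} [Field F] {k n : ℕ} (G : Matrix (Fin k) (Fin n) F) (u : Fin k → F) :
    Fin n → F :=
  u ᵥ* G

/-- The erasure channel: symbol `i` is erased (`none`) when `e i = true`, and is received
correctly otherwise. -/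
def channel {F : Type*} {n : ℕ} (e : Fin n → Bool) (z : Fin n → F) : Fin n → Option F :=
  fun i => if e i = true then none else some (z i)

/-- The positions among the first `m` ones that were not erased. -/
def receivedSet {F : Type*} {n : ℕ} (y : Fin n → Option F) (m : ℕ) : Set (Fin n) :=
  {i | (i : ℕ) < m ∧ (y i).isSome = true}

open Classical in
/-- The output of the on-the-fly decoder after the first `m` channel uses of a packet. If `k`
linearly independent coded symbols have been received, it outputs a message compatible with
the received symbols; otherwise it outputs nothing (`none`). -/
def decode {F : Type*} [Field F] {k n : ℕ} (G : Matrix (Fin k) (Fin n) F) (y : Fin n → Option F)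
    (m : ℕ) : Option (Fin k → F) :=
  if h : Decodable (fun i j => G j i) (receivedSet y m) ∧
      ∃ v : Fin k → F, ∀ i ∈ receivedSet y m, y i = some (encode G v i) then
    some h.2.choose
  else none

/-! ### The transmission policy and the age

Message `m` is generated at time `m`, and one channel use takes place at each time `0, 1, 2, …`.
Packet `l` carries the message `u (l * n)`, generated at time `l * n`; its symbols are sent, and
received without delay, at times `l * n, …, l * n + n - 1`. -/

/-- Packet `l` has been delivered by time `t`: for some channel use `i` of the packet, made no later
than `t`, the decoder has output the transmitted message after that channel use. -/
def DeliveredBy {F : Type*} [Field F] {k n : ℕ} (G : ℕ → Matrix (Fin k) (Fin n) F)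
    (e : ℕ → Fin n → Bool) (u : ℕ → Fin k → F) (l : ℕ) (t : ℝ) : Prop :=
  ∃ i : Fin n,
    decode (G l) (channel (e l) (encode (G l) (u (l * n)))) ((i : ℕ) + 1) = some (u (l * n)) ∧
    ((l * n + (i : ℕ) : ℕ) : ℝ) ≤ t

/-- The generation time of the freshest message delivered by time `t`. The receiver starts with an
update of age `a₀` at time `0`. -/
def freshest {F : Type*} [Field F] {k n : ℕ} (G : ℕ → Matrix (Fin k) (Fin n) F)
    (e : ℕ → Fin n → Bool) (u : ℕ → Fin k → F) (a₀ : ℝ) (t : ℝ) : ℝ :=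
  sSup (insert (-a₀) {s : ℝ | ∃ l : ℕ, DeliveredBy G e u l t ∧ s = ((l * n : ℕ) : ℝ)})

/-- The instantaneous age. -/
def age {F : Type*} [Field F] {k n : ℕ} (G : ℕ → Matrix (Fin k) (Fin n) F)
    (e : ℕ → Fin n → Bool) (u : ℕ → Fin k → F) (a₀ : ℝ) (t : ℝ) : ℝ :=
  t - freshest G e u a₀ t

/-- The age function `Δ` has time average `a`. -/
def HasAverageAge (Δ : ℝ → ℝ) (a : ℝ) : Prop :=
  (∀ τ : ℝ, 0 ≤ τ → IntervalIntegrable Δ volume 0 τ) ∧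
    Tendsto (fun τ : ℝ => (1 / τ) * ∫ t in (0 : ℝ)..τ, Δ t) atTop (𝓝 a)

/-! ### The randomness -/

/-- The law of the pair (generator column, erasure indicator) of one channel use: the column is
uniform on the nonzero vectors of `F ^ k`, and independently the symbol is erased with
probability `ε`. -/
def useLaw (F : Type*) [Field F] [MeasurableSpace F] (k : ℕ) (ε : unitInterval) :
    Measure ((Fin k → F) × Bool) :=
  (uniformOn {v : Fin k → F | v ≠ 0}).prod (bernoulliMeasure true false ε)

/-- The law of an unlimited i.i.d. sequence of channel uses for one packet. -/
def packetLaw (F : Type*) [Field F] [MeasurableSpace F] (k : ℕ) (ε : unitInterval) :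
    Measure (ℕ → (Fin k → F) × Bool) :=
  Measure.infinitePi (fun _ => useLaw F k ε)

/-- `B`: the number of channel uses until `k` linearly independent coded symbols are received
(`⊤` if this never happens). -/
def B {F : Type*} [Field F] {k : ℕ} (x : ℕ → (Fin k → F) × Bool) : ℕ∞ :=
  ⨅ (m : ℕ) (_ : Decodable (fun i => (x i).1) {i : ℕ | i < m ∧ (x i).2 = false}), (m : ℕ∞)

/-- The packet erasure probability `ε_p = P(B > n)`. -/
def erasureProb (F : Type*) [Field F] [MeasurableSpace F] (k n : ℕ) (ε : unitInterval) : ℝ :=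
  (packetLaw F k ε).real {x | (n : ℕ∞) < B x}

/-- `E(T)`, where `T` is distributed as `B` conditioned on `B ≤ n`. -/
def meanT (F : Type*) [Field F] [MeasurableSpace F] (k n : ℕ) (ε : unitInterval) : ℝ :=
  ∫ x, ((B x).toNat : ℝ) ∂((packetLaw F k ε)[|{x | B x ≤ (n : ℕ∞)}])

end

end RandomLinearScheme

/-! Let `A l` be the age just before slot `l`, let `I l` indicate success, and let `X l` be `n - (B
- 1)` on success and `0` otherwise. Then `A (l+1) = n + (1 - I l) A l`. The age rises at unit rate
through the slot and drops by `A l` at decoding, so it integrates to `n A l + n²/2 - X l A l`. The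
average age thus reduces to the Cesàro limits of `A l` and `X l * A l`.

`A l` depends on earlier slots only, hence is independent of slot `l`. Telescoping gives `I l * A l`
the average `n`; replacing `I l` by its mean `p = 1 - ε_p` gives `A l` the average `n / p`;
replacing `X l` by its mean `p (n + 1 - E T)` gives `X l * A l` the average `n (n + 1 - E T)`. Both
replacements rest on `ae_tendsto_centred_sum`: the centred terms are orthogonal with bounded second
moments, so their averages vanish along the squares, and monotone partial sums fill the gaps.
Dividing the resulting slot average by `n` yields the formula. -/

namespace RandomLinearScheme

/-! ### The recursion for the starting ages. -/

/-- The age at the beginning of each slot of length `n`, before the channel uses of that slot: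
it is reset to `n` by a success (`I l = 1`) in the preceding slot and grows by `n` otherwise. -/
def startAge (n a₀ : ℝ) (I : ℕ → ℝ) : ℕ → ℝ
  | 0 => a₀
  | l + 1 => n + (1 - I l) * startAge n a₀ I l

lemma startAge_nonneg {n a₀ : ℝ} {I : ℕ → ℝ} (hn : 0 ≤ n) (ha₀ : 0 ≤ a₀) (hI : ∀ l, I l ≤ 1)
    (l : ℕ) : 0 ≤ startAge n a₀ I l := by
  induction l with
  | zero => exact ha₀
  | succ l ih => exact add_nonneg hn (mul_nonneg (sub_nonneg.2 (hI l)) ih)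

lemma startAge_le {n a₀ : ℝ} {I : ℕ → ℝ} (hn : 0 ≤ n) (ha₀ : 0 ≤ a₀) (hI₀ : ∀ l, 0 ≤ I l)
    (hI : ∀ l, I l ≤ 1) (l : ℕ) : startAge n a₀ I l ≤ a₀ + n * l := by
  induction l with
  | zero => simp [startAge]
  | succ l ih =>
    have := mul_nonneg (hI₀ l) (startAge_nonneg hn ha₀ hI l)
    simp only [startAge]
    push_cast
    linarith

/-- The recursion reads `I l * A l = n + A l - A (l+1)`, which telescopes. -/
lemma sum_mul_startAge (n a₀ : ℝ) (I : ℕ → ℝ) (L : ℕ) :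
    ∑ l ∈ Finset.range L, I l * startAge n a₀ I l = n * L + a₀ - startAge n a₀ I L := by
  induction L with
  | zero => simp [startAge]
  | succ L ih => rw [Finset.sum_range_succ, ih]; simp only [startAge]; push_cast; ring

lemma startAge_congr {n a₀ : ℝ} {I J : ℕ → ℝ} {l : ℕ} (h : ∀ i < l, I i = J i) :
    startAge n a₀ I l = startAge n a₀ J l := by
  induction l with
  | zero => rfl
  | succ l ih => simp only [startAge]; rw [h l (by simp), ih fun i hi => h i (by omega)]

/-- A crude bound growing with `l`, used for integrability; the uniform control is
`exists_integral_sq_startAge_le`. -/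
lemma abs_startAge_le {E : Type*} {I : E → ℝ} {n a₀ : ℝ} (hn : 0 ≤ n) (ha₀ : 0 ≤ a₀)
    (hI : ∀ x, I x = 0 ∨ I x = 1) (w : ℕ → E) (l : ℕ) : |startAge n a₀ (fun i => I (w i)) l| ≤ a₀ + n * l := by
  have h0 : ∀ x, 0 ≤ I x := fun x => by rcases hI x with h | h <;> simp [h]
  have h1 : ∀ x, I x ≤ 1 := fun x => by rcases hI x with h | h <;> simp [h]
  rw [abs_of_nonneg (startAge_nonneg hn ha₀ (fun l => h1 _) l)]
  exact startAge_le hn ha₀ (fun l => h0 _) (fun l => h1 _) l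

lemma startAge_comp_congr {E : Type*} (n a₀ : ℝ) (I : E → ℝ) {x y : ℕ → E} {i j : ℕ}
    (h : ∀ a ∈ Set.Iio j, x a = y a) (hij : i ≤ j) :
    startAge n a₀ (fun a => I (x a)) i = startAge n a₀ (fun a => I (y a)) i :=
  startAge_congr fun a ha => by rw [h a (lt_of_lt_of_le ha hij)]

lemma measurable_startAge {E : Type*} [MeasurableSpace E] {I : E → ℝ} (hI : Measurable I)
    (n a₀ : ℝ) (l : ℕ) : Measurable fun w : ℕ → E => startAge n a₀ (fun i => I (w i)) l := by
  induction l with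
  | zero => exact measurable_const
  | succ l ih => simp only [startAge]; fun_prop

/-! ### Tools: almost sure limits, interpolation between squares, independence of the past. -/

/-- Nonnegative random variables with summable expectations tend to zero almost surely. -/
lemma ae_tendsto_zero_of_summable_integral {Ω : Type*} [MeasurableSpace Ω] {P : Measure Ω}
    {f : ℕ → Ω → ℝ} (hf₀ : ∀ m ω, 0 ≤ f m ω) (hf : ∀ m, Integrable (f m) P)
    (hs : Summable fun m => ∫ ω, f m ω ∂P) :
    ∀ᵐ ω ∂P, Tendsto (fun m => f m ω) atTop (𝓝 0) := by
  have h1 : ∫⁻ ω, ∑' m, ENNReal.ofReal (f m ω) ∂P ≠ ⊤ := by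
    rw [lintegral_tsum fun m => (hf m).aemeasurable.ennreal_ofReal]
    simp_rw [← fun m => ofReal_integral_eq_lintegral_ofReal (hf m) (ae_of_all _ (hf₀ m))]
    exact hs.tsum_ofReal_ne_top
  filter_upwards [ae_lt_top' (AEMeasurable.tsum fun m => (hf m).aemeasurable.ennreal_ofReal) h1]
    with ω hω
  have h2 := ENNReal.tendsto_atTop_zero_of_tsum_ne_top hω.ne
  have h3 := (ENNReal.tendsto_toReal ENNReal.zero_ne_top).comp h2
  simpa [Function.comp_def, ENNReal.toReal_ofReal, hf₀] using h3

/-- If a monotone sequence divided by its index converges along the squares, it converges. -/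
lemma tendsto_div_of_monotone_of_sq {u : ℕ → ℝ} {c : ℝ} (hu : Monotone u)
    (h : Tendsto (fun m : ℕ => u (m ^ 2) / (m : ℝ) ^ 2) atTop (𝓝 c)) :
    Tendsto (fun m : ℕ => u m / m) atTop (𝓝 c) := by
  refine tendsto_div_of_monotone_of_exists_subseq_tendsto_div u c hu fun a ha =>
    ⟨fun m => m ^ 2, ?_, tendsto_pow_atTop (by norm_num), by simpa using h⟩
  -- Consecutive squares have ratio tending to `1`, hence eventually below any `a > 1`.
  have h1 : Tendsto (fun m : ℕ => (1 + 1 / (m : ℝ)) ^ 2) atTop (𝓝 ((1 + 0) ^ 2)) :=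
    (tendsto_one_div_atTop_nhds_zero_nat.const_add 1).pow 2
  filter_upwards [(tendsto_order.1 h1).2 a (by simpa using ha), eventually_gt_atTop 0] with m hm h0
  have h0' : (0 : ℝ) < m := by exact_mod_cast h0
  have : (1 + 1 / (m : ℝ)) ^ 2 * (m : ℝ) ^ 2 = ((m : ℝ) + 1) ^ 2 := by field_simp
  push_cast
  rw [← this]
  gcongr

/-- A function of the coordinates before `j` is independent of coordinate `j`. -/
lemma indepFun_of_dependsOn {E Ω : Type*} [MeasurableSpace E] [Nonempty E] [MeasurableSpace Ω]
    {P : Measure Ω} {W : ℕ → Ω → E} (hW : ∀ l, Measurable (W l)) (hind : iIndepFun W P)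
    {Φ : (ℕ → E) → ℝ} (hΦ : Measurable Φ) {j : ℕ} (hdep : DependsOn Φ (Set.Iio j))
    {Y : E → ℝ} (hY : Measurable Y) :
    IndepFun (fun ω => Φ fun l => W l ω) (fun ω => Y (W j ω)) P := by
  classical
  have h := hind.indepFun_finset (Finset.range j) {j} (by simp) hW
  -- The arbitrary tail is harmless: by `hdep`, `Φ` reads only the coordinates before `j`.
  let ext : ((i : Finset.range j) → E) → ℕ → E := fun w i =>
    if h : i ∈ Finset.range j then w ⟨i, h⟩ else Classical.arbitrary E
  have hext : Measurable ext := by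
    refine measurable_pi_lambda _ fun i => ?_
    by_cases hi : i ∈ Finset.range j
    · simp only [ext, hi, dif_pos]; fun_prop
    · simp only [ext, hi, dif_neg, not_false_eq_true]; exact measurable_const
  have h2 := h.comp (hΦ.comp hext)
    (hY.comp (measurable_pi_apply (⟨j, Finset.mem_singleton_self j⟩ : ({j} : Finset ℕ))))
  refine (h2.congr (ae_of_all _ fun ω => ?_) (ae_of_all _ fun ω => rfl))
  refine hdep fun i hi => ?_
  have hi' : i ∈ Finset.range j := by simpa using hi
  simp only [ext, dif_pos hi']

/-! ### Strong laws for sums weighted by the starting ages. -/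

section Renewal

variable {E Ω : Type*} [MeasurableSpace E] [MeasurableSpace Ω] {P : Measure Ω}
  [IsProbabilityMeasure P] {W : ℕ → Ω → E} {I : E → ℝ} {n a₀ p : ℝ}

lemma integrable_comp_of_bound (hW : ∀ l, Measurable (W l)) {Φ : (ℕ → E) → ℝ}
    (hΦ : Measurable Φ) {C : ℝ} (hC : ∀ w, |Φ w| ≤ C) :
    Integrable (fun ω => Φ fun l => W l ω) P :=
  .of_bound (hΦ.comp (measurable_pi_lambda _ hW)).aestronglyMeasurable C
    (ae_of_all _ fun _ => hC _)

/-- Independence of `A l` and `I (W l)` makes the second moments contract: `E A(l+1)² ≤ C + (1 -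
p/2) E A(l)²`. -/
lemma exists_integral_sq_startAge_le [Nonempty E] (hW : ∀ l, Measurable (W l))
    (hind : iIndepFun W P)
    (hIm : Measurable I) (hI : ∀ x, I x = 0 ∨ I x = 1) (hn : 0 ≤ n) (ha₀ : 0 ≤ a₀) (hp : 0 < p)
    (hmean : ∀ l, ∫ ω, I (W l ω) ∂P = p) :
    ∃ K, ∀ l, ∫ ω, startAge n a₀ (fun i => I (W i ω)) l ^ 2 ∂P ≤ K := by
  have h1 : ∀ x, I x ≤ 1 := fun x => by rcases hI x with h | h <;> simp [h]
  have hp1 : p ≤ 1 := by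
    rw [← hmean 0]
    calc ∫ ω, I (W 0 ω) ∂P ≤ ∫ _, (1 : ℝ) ∂P :=
          integral_mono_of_nonneg (ae_of_all _ fun ω => by rcases hI (W 0 ω) with h | h <;> simp [h])
            (integrable_const _) (ae_of_all _ fun ω => h1 _)
      _ = 1 := by simp
  set C : ℝ := n ^ 2 + 2 * n ^ 2 / p with hC
  have hC0 : 0 ≤ C := by positivity
  -- `2 * C / p` is the fixed point of `v ↦ C + (1 - p/2) v`; adding `a₀ ^ 2` covers `l = 0`.
  refine ⟨a₀ ^ 2 + 2 * C / p, fun l => ?_⟩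
  induction l with
  | zero =>
    have : 0 ≤ 2 * C / p := by positivity
    simpa [startAge] using this
  | succ l ih =>
    set A : Ω → ℝ := fun ω => startAge n a₀ (fun i => I (W i ω)) l with hA
    have hA0 : ∀ ω, 0 ≤ A ω := fun ω => startAge_nonneg hn ha₀ (fun l => h1 _) l
    have mA := measurable_startAge hIm n a₀ l
    have iA : Integrable (fun ω => A ω ^ 2) P :=
      integrable_comp_of_bound (Φ := fun w => startAge n a₀ (fun i => I (w i)) l ^ 2)
        hW (mA.pow_const 2) (C := (a₀ + n * l) ^ 2) fun w => by
          rw [abs_pow]; exact pow_le_pow_left₀ (abs_nonneg _) (abs_startAge_le hn ha₀ hI w l) 2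
    have hindep : IndepFun (fun ω => A ω ^ 2) (fun ω => 1 - I (W l ω)) P :=
      indepFun_of_dependsOn hW hind (Φ := fun w => startAge n a₀ (fun i => I (w i)) l ^ 2)
        (mA.pow_const 2) (fun x y h => by
          simp only; rw [startAge_comp_congr n a₀ I h le_rfl]) (hIm.const_sub 1)
    have iI : Integrable (fun ω => I (W l ω)) P :=
      integrable_comp_of_bound (Φ := fun w => I (w l)) hW (by fun_prop) (C := 1) fun w => by
        rcases hI (w l) with h | h <;> simp [h]
    have hprod : ∫ ω, A ω ^ 2 * (1 - I (W l ω)) ∂P = (∫ ω, A ω ^ 2 ∂P) * (1 - p) := by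
      rw [hindep.integral_fun_mul_eq_mul_integral iA.aestronglyMeasurable
        ((integrable_const _).sub iI).aestronglyMeasurable,
        integral_sub (integrable_const _) iI, hmean]
      simp
    have iprod : Integrable (fun ω => A ω ^ 2 * (1 - I (W l ω))) P := by
      refine iA.mul_bdd (c := 1) ((integrable_const _).sub iI).aestronglyMeasurable
        (ae_of_all _ fun ω => ?_)
      rcases hI (W l ω) with h | h <;> simp [h]
    have isum : Integrable (fun ω => A ω ^ 2 * (1 - I (W l ω)) + p / 2 * A ω ^ 2) P :=
      iprod.add (iA.const_mul _)
    have hle : ∫ ω, startAge n a₀ (fun i => I (W i ω)) (l + 1) ^ 2 ∂P ≤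
        ∫ ω, (C + (A ω ^ 2 * (1 - I (W l ω)) + p / 2 * A ω ^ 2)) ∂P := by
      refine integral_mono_of_nonneg (ae_of_all _ fun ω => sq_nonneg _)
        ((integrable_const _).add isum) (ae_of_all _ fun ω => ?_)
      -- The weights spend only half of the contraction `1 - p` on the cross term.
      have key : 2 * n * A ω ≤ 2 * n ^ 2 / p + p / 2 * A ω ^ 2 := by
        have := sq_nonneg (2 * n - p * A ω)
        rw [div_add' _ _ _ hp.ne', le_div_iff₀ hp]
        nlinarith
      simp only [startAge]
      change (n + (1 - I (W l ω)) * A ω) ^ 2 ≤ _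
      have := hA0 ω
      have hx : 0 ≤ 2 * n ^ 2 / p := by positivity
      rcases hI (W l ω) with h | h <;> rw [h] <;> nlinarith [sq_nonneg (A ω)]
    rw [integral_add (integrable_const _) isum,
      integral_add iprod (iA.const_mul _), hprod, integral_const_mul] at hle
    simp only [integral_const, probReal_univ, one_smul] at hle
    set V := ∫ ω, A ω ^ 2 ∂P
    refine hle.trans ?_
    have e1 : C + (V * (1 - p) + p / 2 * V) = C + V * (1 - p / 2) := by ring
    have e2 : V * (1 - p / 2) ≤ (a₀ ^ 2 + 2 * C / p) * (1 - p / 2) :=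
      mul_le_mul_of_nonneg_right ih (by linarith)
    have e3 : (a₀ ^ 2 + 2 * C / p) * (1 - p / 2) = a₀ ^ 2 + 2 * C / p - a₀ ^ 2 * p / 2 - C := by
      field_simp; ring
    have : 0 ≤ a₀ ^ 2 * p / 2 := by positivity
    linarith

/-- The centred sums of `Y (W l)` weighted by the starting ages are negligible along the
squares. -/
lemma ae_tendsto_centred_sum [Nonempty E] (hW : ∀ l, Measurable (W l)) (hind : iIndepFun W P)
    (hIm : Measurable I) (hI : ∀ x, I x = 0 ∨ I x = 1) (hn : 0 ≤ n) (ha₀ : 0 ≤ a₀) (hp : 0 < p)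
    (hmean : ∀ l, ∫ ω, I (W l ω) ∂P = p) {Y : E → ℝ} (hY : Measurable Y) {M : ℝ}
    (hM : ∀ x, |Y x| ≤ M) (hY0 : ∀ l, ∫ ω, Y (W l ω) ∂P = 0) :
    ∀ᵐ ω ∂P, Tendsto (fun m : ℕ => (∑ l ∈ Finset.range (m ^ 2),
      Y (W l ω) * startAge n a₀ (fun i => I (W i ω)) l) / (m : ℝ) ^ 2) atTop (𝓝 0) := by
  obtain ⟨K, hK⟩ := exists_integral_sq_startAge_le hW hind hIm hI hn ha₀ hp hmean
  let A : ℕ → (ℕ → E) → ℝ := fun l w => startAge n a₀ (fun i => I (w i)) l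
  let Z : ℕ → (ℕ → E) → ℝ := fun l w => Y (w l) * A l w
  have mA : ∀ l, Measurable (A l) := measurable_startAge hIm n a₀
  have mZ : ∀ l, Measurable (Z l) := fun l => by
    have := mA l
    simp only [Z]; fun_prop
  have hM0 : 0 ≤ M := (abs_nonneg _).trans (hM (Classical.arbitrary E))
  have bZ : ∀ l w, |Z l w| ≤ M * (a₀ + n * l) := fun l w => by
    rw [abs_mul]
    exact mul_le_mul (hM _) (abs_startAge_le hn ha₀ hI w l) (abs_nonneg _) hM0
  have iZZ : ∀ i j, Integrable (fun ω => Z i (fun l => W l ω) * Z j (fun l => W l ω)) P :=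
    fun i j => integrable_comp_of_bound (Φ := fun w => Z i w * Z j w) hW ((mZ i).mul (mZ j))
      (C := M * (a₀ + n * i) * (M * (a₀ + n * j))) fun w => by
        rw [abs_mul]
        exact mul_le_mul (bZ _ _) (bZ _ _) (abs_nonneg _) (by positivity)
  -- Orthogonality: `Z i * A j` depends on slots before `j`, and the remaining factor `Y (W j)` is
  -- independent of it with mean zero.
  have hlt : ∀ i j, i < j → ∫ ω, Z i (fun l => W l ω) * Z j (fun l => W l ω) ∂P = 0 := by
    intro i j hij
    have hm : Measurable fun w => Z i w * A j w := (mZ i).mul (mA j)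
    have hi := indepFun_of_dependsOn hW hind hm (j := j) (fun x y h => by
      simp only [Z, A]
      rw [startAge_comp_congr n a₀ I h hij.le, startAge_comp_congr n a₀ I h le_rfl, h i hij]) hY
    have := hi.integral_fun_mul_eq_mul_integral
      (hm.comp (measurable_pi_lambda _ hW)).aestronglyMeasurable
      (hY.comp (hW j)).aestronglyMeasurable
    rw [hY0, mul_zero] at this
    rw [← this]
    congr 1; ext ω; simp only [Z]; ring
  have hne : ∀ i j, i ≠ j → ∫ ω, Z i (fun l => W l ω) * Z j (fun l => W l ω) ∂P = 0 := by
    intro i j hij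
    rcases lt_or_gt_of_ne hij with h | h
    · exact hlt i j h
    · rw [← hlt j i h]; congr 1; ext ω; ring
  have hdiag : ∀ i, ∫ ω, Z i (fun l => W l ω) * Z i (fun l => W l ω) ∂P ≤ M ^ 2 * K := by
    intro i
    have iA : Integrable (fun ω => A i (fun l => W l ω) ^ 2) P :=
      integrable_comp_of_bound (Φ := fun w => A i w ^ 2) hW ((mA i).pow_const 2)
        (C := (a₀ + n * i) ^ 2) fun w => by
          rw [abs_pow]; exact pow_le_pow_left₀ (abs_nonneg _) (abs_startAge_le hn ha₀ hI w i) 2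
    calc _ ≤ ∫ ω, M ^ 2 * A i (fun l => W l ω) ^ 2 ∂P := by
          refine integral_mono (iZZ i i) (iA.const_mul _) fun ω => ?_
          simp only [Z]
          calc _ = |Y (W i ω)| ^ 2 * A i (fun l => W l ω) ^ 2 := by rw [sq_abs]; ring
            _ ≤ _ := by gcongr; exact hM _
      _ ≤ _ := by rw [integral_const_mul]; gcongr; exact hK i
  have hsq : ∀ N : ℕ, ∫ ω, (∑ l ∈ Finset.range N, Z l (fun l => W l ω)) ^ 2 ∂P ≤
      N * (M ^ 2 * K) := by
    intro N
    simp_rw [sq (∑ l ∈ Finset.range N, _), Finset.sum_mul_sum]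
    rw [integral_finsetSum _ fun i _ => integrable_finsetSum _ fun j _ => iZZ i j]
    calc _ ≤ ∑ i ∈ Finset.range N, M ^ 2 * K := by
          refine Finset.sum_le_sum fun i hi => ?_
          rw [integral_finsetSum _ fun j _ => iZZ i j,
            Finset.sum_eq_single i (fun j _ h => hne i j h.symm) (fun h => absurd hi h)]
          exact hdiag i
      _ = _ := by simp
  have iS : ∀ N : ℕ, Integrable (fun ω => (∑ l ∈ Finset.range N, Z l (fun l => W l ω)) ^ 2) P := by
    intro N
    simp_rw [sq (∑ l ∈ Finset.range N, _), Finset.sum_mul_sum]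
    exact integrable_finsetSum _ fun i _ => integrable_finsetSum _ fun j _ => iZZ i j
  -- With `N = m ^ 2`, the normalised second moment is at most `M ^ 2 * K / m ^ 2`, which is
  -- summable.
  have hlim := ae_tendsto_zero_of_summable_integral (P := P)
    (f := fun m ω => ((∑ l ∈ Finset.range (m ^ 2), Z l (fun l => W l ω)) / (m : ℝ) ^ 2) ^ 2)
    (fun m ω => sq_nonneg _)
    (fun m => by simp_rw [div_pow]; exact (iS _).div_const _)
    (by
      refine Summable.of_nonneg_of_le (fun m => integral_nonneg fun ω => sq_nonneg _)
        (fun m => ?_) ((Real.summable_one_div_nat_pow.2 one_lt_two).mul_right (M ^ 2 * K))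
      simp_rw [div_pow]
      rw [integral_div]
      rcases Nat.eq_zero_or_pos m with rfl | hm
      · simp
      · have hm' : (0 : ℝ) < m := by exact_mod_cast hm
        rw [div_le_iff₀ (by positivity)]
        refine (hsq (m ^ 2)).trans_eq ?_
        push_cast; field_simp)
  filter_upwards [hlim] with ω hω
  have := hω.sqrt
  simp only [Real.sqrt_sq_eq_abs, Real.sqrt_zero] at this
  exact (tendsto_zero_iff_abs_tendsto_zero _).2 this

/-- Disposes of the boundary term of `sum_mul_startAge`; the second moments are at most `K / m ^ 4`.
-/
lemma ae_tendsto_startAge_div_sq [Nonempty E] (hW : ∀ l, Measurable (W l)) (hind : iIndepFun W P)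
    (hIm : Measurable I) (hI : ∀ x, I x = 0 ∨ I x = 1) (hn : 0 ≤ n) (ha₀ : 0 ≤ a₀) (hp : 0 < p)
    (hmean : ∀ l, ∫ ω, I (W l ω) ∂P = p) :
    ∀ᵐ ω ∂P, Tendsto (fun m : ℕ => startAge n a₀ (fun i => I (W i ω)) (m ^ 2) / (m : ℝ) ^ 2)
      atTop (𝓝 0) := by
  obtain ⟨K, hK⟩ := exists_integral_sq_startAge_le hW hind hIm hI hn ha₀ hp hmean
  have iA : ∀ l, Integrable (fun ω => startAge n a₀ (fun i => I (W i ω)) l ^ 2) P := fun l =>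
    integrable_comp_of_bound (Φ := fun w => startAge n a₀ (fun i => I (w i)) l ^ 2)
      hW ((measurable_startAge hIm n a₀ l).pow_const 2) (C := (a₀ + n * l) ^ 2) fun w => by
        rw [abs_pow]; exact pow_le_pow_left₀ (abs_nonneg _) (abs_startAge_le hn ha₀ hI w l) 2
  have hlim := ae_tendsto_zero_of_summable_integral (P := P)
    (f := fun m ω => (startAge n a₀ (fun i => I (W i ω)) (m ^ 2) / (m : ℝ) ^ 2) ^ 2)
    (fun m ω => sq_nonneg _)
    (fun m => by simp_rw [div_pow]; exact (iA _).div_const _)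
    (by
      refine Summable.of_nonneg_of_le (fun m => integral_nonneg fun ω => sq_nonneg _)
        (fun m => ?_) (((Real.summable_one_div_nat_pow (p := 4)).2 (by norm_num)).mul_right K)
      simp_rw [div_pow]
      rw [integral_div, ← pow_mul, div_mul_eq_mul_div, one_mul]
      exact div_le_div_of_nonneg_right (hK _) (by positivity))
  filter_upwards [hlim] with ω hω
  have := hω.sqrt
  simp only [Real.sqrt_sq_eq_abs, Real.sqrt_zero] at this
  exact (tendsto_zero_iff_abs_tendsto_zero _).2 this

/-- The long-run average of the starting ages. -/
lemma ae_tendsto_average_startAge [Nonempty E] (hW : ∀ l, Measurable (W l))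
    (hind : iIndepFun W P)
    (hIm : Measurable I) (hI : ∀ x, I x = 0 ∨ I x = 1) (hn : 0 ≤ n) (ha₀ : 0 ≤ a₀) (hp : 0 < p)
    (hmean : ∀ l, ∫ ω, I (W l ω) ∂P = p) :
    ∀ᵐ ω ∂P, Tendsto (fun L : ℕ => (∑ l ∈ Finset.range L,
      startAge n a₀ (fun i => I (W i ω)) l) / L) atTop (𝓝 (n / p)) := by
  have h1 : ∀ x, I x ≤ 1 := fun x => by rcases hI x with h | h <;> simp [h]
  have iI : ∀ l, Integrable (fun ω => I (W l ω)) P := fun l =>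
    integrable_comp_of_bound (Φ := fun w => I (w l)) hW (by fun_prop) (C := 1) fun w => by
      rcases hI (w l) with h | h <;> simp [h]
  have hc := ae_tendsto_centred_sum (Y := fun x => I x - p) hW hind hIm hI hn ha₀ hp hmean
    (hIm.sub_const p) (M := 1 + p) (fun x => by
      rcases hI x with h | h <;> rw [h, abs_le] <;> constructor <;> linarith)
    (fun l => by rw [integral_sub (iI l) (integrable_const _), hmean]; simp)
  filter_upwards [hc, ae_tendsto_startAge_div_sq hW hind hIm hI hn ha₀ hp hmean] with ω hω hω'
  refine tendsto_div_of_monotone_of_sq (u := fun L => ∑ l ∈ Finset.range L,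
      startAge n a₀ (fun i => I (W i ω)) l) ?_ ?_
  · exact monotone_nat_of_le_succ fun L => by
      rw [Finset.sum_range_succ]
      linarith [startAge_nonneg hn ha₀ (fun l => h1 (W l ω)) L]
  · have h0 : Tendsto (fun m : ℕ => a₀ / (m : ℝ) ^ 2) atTop (𝓝 0) :=
      tendsto_const_nhds.div_atTop
        ((tendsto_pow_atTop two_ne_zero).comp tendsto_natCast_atTop_atTop)
    -- Telescoping gives `p ∑ A l = n L + a₀ - A L - ∑ (I l - p) A l`, used with `L = m ^ 2`.
    have := (((tendsto_const_nhds (x := n)).add h0).sub hω').sub hω |>.div_const p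
    rw [add_zero, sub_zero, sub_zero] at this
    refine this.congr' ?_
    filter_upwards [eventually_gt_atTop 0] with m hm
    have hm' : (0 : ℝ) < m := by exact_mod_cast hm
    simp_rw [sub_mul, Finset.sum_sub_distrib, ← Finset.mul_sum, sum_mul_startAge]
    push_cast
    field_simp
    ring

/-- The long-run average of the starting ages, weighted by i.i.d. factors each independent of the
starting age. -/
lemma ae_tendsto_average_mul_startAge [Nonempty E] (hW : ∀ l, Measurable (W l))
    (hind : iIndepFun W P)
    (hIm : Measurable I) (hI : ∀ x, I x = 0 ∨ I x = 1) (hn : 0 ≤ n) (ha₀ : 0 ≤ a₀) (hp : 0 < p)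
    (hmean : ∀ l, ∫ ω, I (W l ω) ∂P = p) {X : E → ℝ} (hX : Measurable X) (hX0 : ∀ x, 0 ≤ X x)
    {M : ℝ} (hXM : ∀ x, X x ≤ M) {μ : ℝ} (hXmean : ∀ l, ∫ ω, X (W l ω) ∂P = μ) :
    ∀ᵐ ω ∂P, Tendsto (fun L : ℕ => (∑ l ∈ Finset.range L,
      X (W l ω) * startAge n a₀ (fun i => I (W i ω)) l) / L) atTop (𝓝 (μ * (n / p))) := by
  have h1 : ∀ x, I x ≤ 1 := fun x => by rcases hI x with h | h <;> simp [h]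
  have iX : ∀ l, Integrable (fun ω => X (W l ω)) P := fun l =>
    integrable_comp_of_bound (Φ := fun w => X (w l)) hW (by fun_prop) (C := M) fun w => by
      rw [abs_of_nonneg (hX0 _)]; exact hXM _
  have hc := ae_tendsto_centred_sum (Y := fun x => X x - μ) hW hind hIm hI hn ha₀ hp hmean
    (hX.sub_const μ) (M := M + |μ|) (fun x => (abs_sub _ _).trans (by
      rw [abs_of_nonneg (hX0 _)]; gcongr; exact hXM _))
    (fun l => by rw [integral_sub (iX l) (integrable_const _), hXmean]; simp)
  filter_upwards [hc, ae_tendsto_average_startAge hW hind hIm hI hn ha₀ hp hmean] with ω hω hω'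
  refine tendsto_div_of_monotone_of_sq (u := fun L => ∑ l ∈ Finset.range L,
      X (W l ω) * startAge n a₀ (fun i => I (W i ω)) l) ?_ ?_
  · exact monotone_nat_of_le_succ fun L => by
      rw [Finset.sum_range_succ]
      linarith [mul_nonneg (hX0 (W L ω)) (startAge_nonneg hn ha₀ (fun l => h1 (W l ω)) L)]
  · have h2 := hω'.comp (tendsto_pow_atTop (α := ℕ) two_ne_zero)
    have := hω.add (h2.const_mul μ)
    rw [zero_add] at this
    refine this.congr fun m => ?_
    simp only [Function.comp_apply]
    simp_rw [sub_mul, Finset.sum_sub_distrib, ← Finset.mul_sum]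
    push_cast
    ring

end Renewal

/-! ### Decoding of one packet in terms of `B`. -/

section Decoder

variable {F : Type*} [Field F] {k n : ℕ}

lemma Decodable.mono {ι : Type*} {col : ι → Fin k → F} {R S : Set ι} (h : Decodable col R)
    (hRS : R ⊆ S) : Decodable col S :=
  let ⟨s, hs, hli⟩ := h
  ⟨s, fun j => hRS (hs j), hli⟩

/-- A decodable set of coded symbols determines the message. -/
lemma Decodable.eq_of_encode_eq {G : Matrix (Fin k) (Fin n) F} {R : Set (Fin n)}
    (h : Decodable (fun i j => G j i) R) {u v : Fin k → F}
    (huv : ∀ i ∈ R, encode G u i = encode G v i) : u = v := by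
  obtain ⟨s, hs, hli⟩ := h
  have hM : IsUnit (Matrix.of fun (i j : Fin k) => G j (s i)) :=
    Matrix.linearIndependent_rows_iff_isUnit.1 hli
  refine Matrix.mulVec_injective_of_isUnit hM (funext fun i => ?_)
  have := huv (s i) (hs i)
  simp only [encode, Matrix.vecMul, Matrix.mulVec, dotProduct, Matrix.of_apply] at this ⊢
  simpa only [mul_comm] using this

/-- The sent message is always compatible with what was received, and full rank makes it the only
one, so `choose` must return it. -/
lemma decode_channel_eq_some_iff (G : Matrix (Fin k) (Fin n) F) (e : Fin n → Bool)
    (u : Fin k → F) (m : ℕ) :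
    decode G (channel e (encode G u)) m = some u ↔
      Decodable (fun i j => G j i) (receivedSet (channel e (encode G u)) m) := by
  have hu : ∀ i ∈ receivedSet (channel e (encode G u)) m,
      channel e (encode G u) i = some (encode G u i) := by
    rintro i ⟨-, hi⟩
    unfold channel at hi ⊢
    split_ifs with h
    · simp [h] at hi
    · rfl
  constructor
  · intro h
    by_contra hd
    simp [decode, hd] at h
  · intro h
    have hex : Decodable (fun i j => G j i) (receivedSet (channel e (encode G u)) m) ∧
        ∃ v : Fin k → F, ∀ i ∈ receivedSet (channel e (encode G u)) m,
          channel e (encode G u) i = some (encode G v i) := ⟨h, u, hu⟩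
    rw [decode, dif_pos hex, Option.some_inj]
    refine h.eq_of_encode_eq fun i hi => ?_
    have := hex.2.choose_spec i hi
    rw [hu i hi, Option.some_inj] at this
    exact this.symm

/-- Decodability is monotone in the number of uses, so the infimum acts as a threshold. -/
lemma B_le_iff (x : ℕ → (Fin k → F) × Bool) (m : ℕ) :
    B x ≤ m ↔ Decodable (fun i => (x i).1) {i : ℕ | i < m ∧ (x i).2 = false} := by
  constructor
  · intro h
    by_contra hd
    have : ((m + 1 : ℕ) : ℕ∞) ≤ B x := le_iInf₂ fun m' hm' => by
      by_contra hlt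
      have hle : m' ≤ m := by
        rw [not_le] at hlt
        have := ENat.natCast_lt_natCast.1 hlt
        omega
      exact hd (hm'.mono fun i hi => ⟨hi.1.trans_le hle, hi.2⟩)
    have := ENat.natCast_le_natCast.1 (this.trans h)
    omega
  · exact fun h => iInf₂_le m h

lemma one_le_B (hk : 1 ≤ k) (x : ℕ → (Fin k → F) × Bool) : 1 ≤ B x := by
  by_contra h
  have h0 : B x ≤ (0 : ℕ) := by
    rw [not_le, Order.lt_one_iff] at h
    simp [h]
  obtain ⟨s, hs, -⟩ := (B_le_iff x 0).1 h0
  exact absurd (hs ⟨0, hk⟩).1 (Nat.not_lt_zero _)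

/-- The channel uses of one packet, followed by erasures only. -/
def padUses (y : Fin n → (Fin k → F) × Bool) : ℕ → (Fin k → F) × Bool :=
  fun i => if h : i < n then y ⟨i, h⟩ else (0, true)

lemma decodable_padUses_iff (y : Fin n → (Fin k → F) × Bool) (m : ℕ) :
    Decodable (fun i => (padUses y i).1) {i : ℕ | i < m ∧ (padUses y i).2 = false} ↔
      Decodable (fun i => (y i).1) {i : Fin n | (i : ℕ) < m ∧ (y i).2 = false} := by
  constructor
  · rintro ⟨s, hs, hli⟩
    have hsn : ∀ j, s j < n := fun j => by
      by_contra h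
      simpa [padUses, h] using (hs j).2
    have hy : ∀ j, padUses y (s j) = y ⟨s j, hsn j⟩ := fun j => by simp [padUses, hsn j]
    refine ⟨fun j => ⟨s j, hsn j⟩, fun j => ⟨(hs j).1, ?_⟩, ?_⟩
    · rw [← hy]; exact (hs j).2
    · simpa only [hy] using hli
  · rintro ⟨s, hs, hli⟩
    have hy : ∀ j, padUses y (s j) = y (s j) := fun j => by simp [padUses]
    refine ⟨fun j => s j, fun j => ⟨(hs j).1, ?_⟩, ?_⟩
    · rw [hy]; exact (hs j).2
    · simpa only [hy] using hli

/-- Within the first `n` channel uses, the decoding time only depends on these uses. -/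
lemma B_padUses_le_iff (x : ℕ → (Fin k → F) × Bool) {m : ℕ} (hm : m ≤ n) :
    B (padUses fun i : Fin n => x i) ≤ m ↔ B x ≤ m := by
  rw [B_le_iff, B_le_iff]
  have hp : ∀ i < n, padUses (fun i : Fin n => x i) i = x i := fun i hi => by simp [padUses, hi]
  constructor
  · rintro ⟨s, hs, hli⟩
    have h : ∀ j, padUses (fun i : Fin n => x i) (s j) = x (s j) :=
      fun j => hp _ ((hs j).1.trans_le hm)
    exact ⟨s, fun j => ⟨(hs j).1, h j ▸ (hs j).2⟩, by simpa only [h] using hli⟩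
  · rintro ⟨s, hs, hli⟩
    have h : ∀ j, padUses (fun i : Fin n => x i) (s j) = x (s j) :=
      fun j => hp _ ((hs j).1.trans_le hm)
    exact ⟨s, fun j => ⟨(hs j).1, (h j).symm ▸ (hs j).2⟩, by simpa only [h] using hli⟩

lemma B_padUses_eq (x : ℕ → (Fin k → F) × Bool) (h : B x ≤ n) :
    B (padUses fun i : Fin n => x i) = B x := by
  obtain ⟨b, hb⟩ := ENat.ne_top_iff_exists.1 (ne_top_of_le_ne_top (ENat.natCast_ne_top n) h)
  have h' := (B_padUses_le_iff (n := n) x le_rfl).2 h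
  obtain ⟨c, hc⟩ := ENat.ne_top_iff_exists.1 (ne_top_of_le_ne_top (ENat.natCast_ne_top n) h')
  have hbn : b ≤ n := by rw [← hb] at h; exact_mod_cast h
  have hcn : c ≤ n := by rw [← hc] at h'; exact_mod_cast h'
  apply le_antisymm
  · rw [← hb]; exact (B_padUses_le_iff x hbn).2 hb.ge
  · rw [← hc]; exact (B_padUses_le_iff x hcn).1 hc.ge

/-- Packet `l` is delivered exactly when its decoding time `B` is at most `n`, and then at its
`B`-th channel use. -/
lemma deliveredBy_iff (hk : 1 ≤ k) (G : ℕ → Matrix (Fin k) (Fin n) F) (e : ℕ → Fin n → Bool)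
    (u : ℕ → Fin k → F) (l : ℕ) (t : ℝ) :
    DeliveredBy G e u l t ↔
      B (padUses fun i => ((fun j => G l j i), e l i)) ≤ n ∧
      ((l * n + ((B (padUses fun i => ((fun j => G l j i), e l i))).toNat - 1) : ℕ) : ℝ) ≤ t := by
  set y : Fin n → (Fin k → F) × Bool := fun i => ((fun j => G l j i), e l i) with hy
  have key : ∀ m : ℕ,
      decode (G l) (channel (e l) (encode (G l) (u (l * n)))) m = some (u (l * n)) ↔
        B (padUses y) ≤ m := by
    intro m
    rw [decode_channel_eq_some_iff, B_le_iff, decodable_padUses_iff]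
    have : receivedSet (channel (e l) (encode (G l) (u (l * n)))) m =
        {i : Fin n | (i : ℕ) < m ∧ (y i).2 = false} := by
      ext i
      simp only [receivedSet, channel, hy, Set.mem_ofPred_eq]
      cases e l i <;> simp
    rw [this]
  simp only [DeliveredBy, key]
  have h1 := one_le_B hk (padUses y)
  constructor
  · rintro ⟨i, hi, ht⟩
    have hin : B (padUses y) ≤ n := hi.trans (by exact_mod_cast i.2)
    refine ⟨hin, le_trans ?_ ht⟩
    have := ENat.toNat_le_toNat hi (ENat.natCast_ne_top _)
    rw [ENat.toNat_natCast] at this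
    exact_mod_cast (by omega)
  · rintro ⟨hn, ht⟩
    obtain ⟨b, hb⟩ := ENat.ne_top_iff_exists.1 (ne_top_of_le_ne_top (ENat.natCast_ne_top n) hn)
    rw [← hb] at hn h1 ht ⊢
    have hn' : b ≤ n := by exact_mod_cast hn
    have h1' : 1 ≤ b := by exact_mod_cast h1
    rw [ENat.toNat_natCast] at ht
    -- Uses are indexed from `0`, so the `b`-th one has index `b - 1`; `1 ≤ b` comes from `1 ≤ k`.
    refine ⟨⟨b - 1, by omega⟩, ?_, ht⟩
    simp only [Nat.sub_add_cancel h1']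
    exact le_rfl

end Decoder

/-! ### The age along a fixed sample path. -/

section SamplePath

variable {n : ℕ} {a₀ : ℝ} {S : ℕ → Prop} [DecidablePred S] {d : ℕ → ℕ}

/-- The generation time of the freshest packet delivered in the first `l` slots. -/
lemma isGreatest_sub_startAge (ha₀ : 0 ≤ a₀) (l : ℕ) :
    IsGreatest (insert (-a₀) {s : ℝ | ∃ j < l, S j ∧ s = ((j * n : ℕ) : ℝ)})
      (l * n - startAge n a₀ (fun l => if S l then 1 else 0) l) := by
  induction l with
  | zero => simp [startAge, isGreatest_singleton]
  | succ l ih =>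
    by_cases hS : S l
    · have : ((l + 1 : ℕ) : ℝ) * n - startAge n a₀ (fun l => if S l then 1 else 0) (l + 1) =
          ((l * n : ℕ) : ℝ) := by
        simp [startAge, hS]; ring
      rw [this]
      refine ⟨Or.inr ⟨l, by simp, hS, rfl⟩, ?_⟩
      rintro s (rfl | ⟨j, hj, -, rfl⟩)
      · exact (neg_nonpos.2 ha₀).trans (Nat.cast_nonneg _)
      · exact_mod_cast Nat.mul_le_mul_right n (by omega)
    · have : ((l + 1 : ℕ) : ℝ) * n - startAge n a₀ (fun l => if S l then 1 else 0) (l + 1) =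
          l * n - startAge n a₀ (fun l => if S l then 1 else 0) l := by
        simp [startAge, hS]; ring
      rw [this]
      convert ih using 3
      ext s
      constructor
      · rintro ⟨j, hj, hSj, rfl⟩
        have : j ≠ l := fun h => hS (h ▸ hSj)
        exact ⟨j, by omega, hSj, rfl⟩
      · rintro ⟨j, hj, hSj, rfl⟩
        exact ⟨j, by omega, hSj, rfl⟩

/-- The age in slot `l`, when packet `j` is delivered iff `S j`, at channel use `d j` of its
slot. -/
lemma sub_sSup_eq (ha₀ : 0 ≤ a₀) (hd : ∀ l, S l → d l < n) {l : ℕ} {t : ℝ}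
    (ht : t ∈ Set.Ico ((l : ℝ) * n) (l * n + n)) :
    t - sSup (insert (-a₀)
        {s : ℝ | ∃ j : ℕ, (S j ∧ ((j * n + d j : ℕ) : ℝ) ≤ t) ∧ s = ((j * n : ℕ) : ℝ)}) =
      t - l * n + if S l ∧ (l : ℝ) * n + d l ≤ t then 0 else
        startAge n a₀ (fun l => if S l then 1 else 0) l := by
  -- As `d j < n`, every earlier success is already delivered, and later packets have not begun;
  -- only packet `l` is in doubt.
  have hbefore : ∀ j < l, S j → ((j * n + d j : ℕ) : ℝ) ≤ t := fun j hj hS => by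
    refine le_trans ?_ ht.1
    have := hd j hS
    have h2 : (j + 1) * n ≤ l * n := Nat.mul_le_mul_right n hj
    have : j * n + d j ≤ l * n := by nlinarith
    exact_mod_cast this
  have hafter : ∀ j, ((j * n + d j : ℕ) : ℝ) ≤ t → j ≤ l := fun j hj => by
    by_contra h
    have h2 : (l + 1) * n ≤ j * n := Nat.mul_le_mul_right n (by omega)
    have h3 : (((l + 1) * n : ℕ) : ℝ) ≤ t := le_trans (by exact_mod_cast (by omega)) hj
    push_cast at h3
    linarith [ht.2]
  by_cases h : S l ∧ (l : ℝ) * n + d l ≤ t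
  · have : IsGreatest (insert (-a₀)
        {s : ℝ | ∃ j : ℕ, (S j ∧ ((j * n + d j : ℕ) : ℝ) ≤ t) ∧ s = ((j * n : ℕ) : ℝ)})
        ((l * n : ℕ) : ℝ) := by
      refine ⟨Or.inr ⟨l, ⟨h.1, by exact_mod_cast h.2⟩, rfl⟩, ?_⟩
      rintro s (rfl | ⟨j, ⟨-, hj⟩, rfl⟩)
      · exact (neg_nonpos.2 ha₀).trans (Nat.cast_nonneg _)
      · exact_mod_cast Nat.mul_le_mul_right n (hafter j hj)
    rw [this.csSup_eq, if_pos h]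
    push_cast; ring
  · have : {s : ℝ | ∃ j : ℕ, (S j ∧ ((j * n + d j : ℕ) : ℝ) ≤ t) ∧ s = ((j * n : ℕ) : ℝ)} =
        {s : ℝ | ∃ j < l, S j ∧ s = ((j * n : ℕ) : ℝ)} := by
      ext s
      constructor
      · rintro ⟨j, ⟨hS, hj⟩, rfl⟩
        refine ⟨j, lt_of_le_of_ne (hafter j hj) ?_, hS, rfl⟩
        rintro rfl
        exact h ⟨hS, by exact_mod_cast hj⟩
      · rintro ⟨j, hj, hS, rfl⟩
        exact ⟨j, ⟨hS, hbefore j hj hS⟩, rfl⟩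
    rw [this, (isGreatest_sub_startAge ha₀ l).csSup_eq, if_neg h]
    ring

/-- The age jumps at the right end of a piece, a null set for the integral. -/
lemma intervalIntegral_congr_Ico {f g : ℝ → ℝ} {a b : ℝ} (hab : a ≤ b) (hg : Continuous g)
    (h : ∀ t ∈ Set.Ico a b, f t = g t) :
    IntervalIntegrable f volume a b ∧ ∫ t in a..b, f t = ∫ t in a..b, g t := by
  have hae : f =ᵐ[volume.restrict (Set.Ioc a b)] g := by
    rw [← Measure.restrict_congr_set Ico_ae_eq_Ioc]
    filter_upwards [ae_restrict_mem measurableSet_Ico] with t ht using h t ht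
  constructor
  · rw [intervalIntegrable_iff_integrableOn_Ioc_of_le hab]
    exact Integrable.congr
      ((intervalIntegrable_iff_integrableOn_Ioc_of_le hab).1 (hg.intervalIntegrable a b)) hae.symm
  · rw [intervalIntegral.integral_of_le hab, intervalIntegral.integral_of_le hab]
    exact integral_congr_ae hae

/-- The integral over a slot of length `n` of an age that grows at unit rate from `A` and drops by
`A` after time `b`. -/
lemma integral_slot {Δ : ℝ → ℝ} {c n b A : ℝ} (hb : 0 ≤ b) (hbn : b ≤ n)
    (h1 : ∀ t ∈ Set.Ico c (c + b), Δ t = t - c + A)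
    (h2 : ∀ t ∈ Set.Ico (c + b) (c + n), Δ t = t - c) :
    IntervalIntegrable Δ volume c (c + n) ∧
      ∫ t in c..(c + n), Δ t = n * A + n ^ 2 / 2 - (n - b) * A := by
  obtain ⟨i1, e1⟩ := intervalIntegral_congr_Ico (by linarith)
    (g := fun t => t - c + A) (by fun_prop) h1
  obtain ⟨i2, e2⟩ := intervalIntegral_congr_Ico (by linarith)
    (g := fun t => t - c) (by fun_prop) h2
  refine ⟨i1.trans i2, ?_⟩
  rw [← intervalIntegral.integral_add_adjacent_intervals i1 i2, e1, e2]
  simp_rw [sub_add]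
  have hlin : ∀ a b r : ℝ, ∫ t in a..b, (t - r) = (b ^ 2 - a ^ 2) / 2 - (b - a) * r :=
    fun a b r => by
      rw [intervalIntegral.integral_sub (by simp) (by simp), integral_id,
        intervalIntegral.integral_const, smul_eq_mul]
  rw [hlin, hlin]
  ring

/-- The time average of a nonnegative function can be computed along multiples of `n`. -/
lemma hasAverageAge_of_tendsto_slots {Δ : ℝ → ℝ} {n γ : ℝ} (hn : 0 < n) (hΔ : ∀ t, 0 ≤ t → 0 ≤ Δ t)
    (hint : ∀ L : ℕ, IntervalIntegrable Δ volume 0 (L * n))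
    (hlim : Tendsto (fun L : ℕ => (∫ t in (0 : ℝ)..(L * n), Δ t) / L) atTop (𝓝 γ)) :
    HasAverageAge Δ (γ / n) := by
  have hint' : ∀ τ : ℝ, 0 ≤ τ → IntervalIntegrable Δ volume 0 τ := fun τ hτ => by
    refine (hint ⌈τ / n⌉₊).mono_set ?_
    have := Nat.le_ceil (τ / n)
    rw [div_le_iff₀ hn] at this
    rw [Set.uIcc_of_le hτ, Set.uIcc_of_le (by positivity)]
    exact Set.Icc_subset_Icc_right this
  refine ⟨hint', ?_⟩
  set Φ : ℝ → ℝ := fun τ => ∫ t in (0 : ℝ)..τ, Δ t with hΦ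
  have hmono : ∀ a b, 0 ≤ a → a ≤ b → Φ a ≤ Φ b := fun a b ha hab =>
    intervalIntegral.integral_mono_interval le_rfl ha hab
      ((ae_restrict_iff' measurableSet_Ioc).2 (ae_of_all _ fun t ht => hΔ t ht.1.le))
      (hint' b (ha.trans hab))
  have hdiv : Tendsto (fun τ : ℝ => τ / n) atTop atTop := tendsto_id.atTop_div_const hn
  have hfl : Tendsto (fun τ : ℝ => ⌊τ / n⌋₊) atTop atTop := tendsto_nat_floor_atTop.comp hdiv
  have hr : Tendsto (fun τ : ℝ => (⌊τ / n⌋₊ : ℝ) / (τ / n)) atTop (𝓝 1) :=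
    tendsto_nat_floor_div_atTop.comp hdiv
  have hr' : Tendsto (fun τ : ℝ => ((⌊τ / n⌋₊ : ℝ) + 1) / (τ / n)) atTop (𝓝 1) := by
    have := hr.add ((tendsto_const_nhds (x := (1 : ℝ))).div_atTop hdiv)
    rw [add_zero] at this
    exact this.congr fun τ => by ring
  -- The integral up to `τ` lies between those up to the neighbouring multiples of `n`; both bounds,
  -- divided by `τ`, tend to `γ / n`.
  have low := ((hlim.comp hfl).mul hr).div_const n
  have upp := ((hlim.comp ((tendsto_add_atTop_nat 1).comp hfl)).mul hr').div_const n
  rw [mul_one] at low upp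
  refine tendsto_of_tendsto_of_tendsto_of_le_of_le' low upp ?_ ?_
  · filter_upwards [eventually_ge_atTop n] with τ hτ
    have hτ0 : 0 < τ := hn.trans_le hτ
    have hL : 0 < ⌊τ / n⌋₊ := Nat.floor_pos.2 ((one_le_div hn).2 hτ)
    have hL' : (0 : ℝ) < ⌊τ / n⌋₊ := by exact_mod_cast hL
    have h1 : (⌊τ / n⌋₊ : ℝ) * n ≤ τ := by
      have := Nat.floor_le (div_nonneg hτ0.le hn.le)
      rwa [le_div_iff₀ hn] at this
    have h2 := hmono _ _ (by positivity) h1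
    calc _ = 1 / τ * Φ (⌊τ / n⌋₊ * n) := by
          simp only [Function.comp_apply]; change Φ _ / _ * _ / _ = _; field_simp
      _ ≤ _ := by gcongr
  · filter_upwards [eventually_ge_atTop n] with τ hτ
    have hτ0 : 0 < τ := hn.trans_le hτ
    have h1 : τ ≤ ((⌊τ / n⌋₊ + 1 : ℕ) : ℝ) * n := by
      have := (Nat.lt_floor_add_one (τ / n)).le
      rw [div_le_iff₀ hn] at this
      exact_mod_cast this
    have h2 := hmono _ _ hτ0.le h1
    calc _ ≤ 1 / τ * Φ ((⌊τ / n⌋₊ + 1 : ℕ) * n) := by gcongr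
      _ = _ := by
        simp only [Function.comp_apply]
        change _ = Φ _ / _ * _ / _
        push_cast
        field_simp

/-- The average age of a sample path in terms of Cesàro limits of the starting ages. -/
lemma hasAverageAge_of_tendsto (hn : 0 < n) (ha₀ : 0 ≤ a₀) (hd : ∀ l, S l → d l < n)
    {Δ : ℝ → ℝ} (hΔ : ∀ t, Δ t = t - sSup (insert (-a₀)
        {s : ℝ | ∃ j : ℕ, (S j ∧ ((j * n + d j : ℕ) : ℝ) ≤ t) ∧ s = ((j * n : ℕ) : ℝ)}))
    {α β : ℝ}
    (hα : Tendsto (fun L : ℕ => (∑ l ∈ Finset.range L,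
      startAge n a₀ (fun l => if S l then 1 else 0) l) / L) atTop (𝓝 α))
    (hβ : Tendsto (fun L : ℕ => (∑ l ∈ Finset.range L, (if S l then (n : ℝ) - d l else 0) *
      startAge n a₀ (fun l => if S l then 1 else 0) l) / L) atTop (𝓝 β)) :
    HasAverageAge Δ ((n * α + n ^ 2 / 2 - β) / n) := by
  have hn' : (0 : ℝ) < n := by exact_mod_cast hn
  set A : ℕ → ℝ := startAge n a₀ (fun l => if S l then 1 else 0) with hA
  have hA0 : ∀ l, 0 ≤ A l := startAge_nonneg hn'.le ha₀ fun l => by split_ifs <;> norm_num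
  have hslot : ∀ l : ℕ, IntervalIntegrable Δ volume (l * n) ((l + 1 : ℕ) * n) ∧
      ∫ t in (l * n : ℝ)..((l + 1 : ℕ) * n), Δ t =
        n * A l + n ^ 2 / 2 - (if S l then (n : ℝ) - d l else 0) * A l := by
    intro l
    have e : ((l + 1 : ℕ) : ℝ) * n = l * n + n := by push_cast; ring
    rw [e]
    by_cases hS : S l
    · have hdn : (d l : ℝ) ≤ n := by exact_mod_cast (hd l hS).le
      have := integral_slot (Δ := Δ) (c := l * n) (n := n) (b := d l) (A := A l)
        (Nat.cast_nonneg _) hdn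
        (fun t ht => by
          rw [hΔ, sub_sSup_eq ha₀ hd ⟨ht.1, ht.2.trans_le (by linarith)⟩,
            if_neg fun h => ht.2.not_ge h.2])
        (fun t ht => by
          have h0 : (0 : ℝ) ≤ d l := Nat.cast_nonneg _
          rw [hΔ, sub_sSup_eq ha₀ hd ⟨le_trans (by linarith) ht.1, ht.2⟩, if_pos ⟨hS, ht.1⟩,
            add_zero])
      rwa [if_pos hS]
    -- For a lost packet the drop is placed at the end of the slot, leaving an empty second piece.
    · have := integral_slot (Δ := Δ) (c := l * n) (n := n) (b := n) (A := A l)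
        hn'.le le_rfl
        (fun t ht => by rw [hΔ, sub_sSup_eq ha₀ hd ht, if_neg fun h => hS h.1])
        (fun t ht => absurd ht (by simp))
      rw [if_neg hS]
      simpa using this
  have hint : ∀ L : ℕ, IntervalIntegrable Δ volume 0 (L * n) := fun L => by
    simpa using IntervalIntegrable.trans_iterate (a := fun l : ℕ => (l * n : ℝ)) (n := L)
      fun l _ => (hslot l).1
  refine hasAverageAge_of_tendsto_slots hn' (fun t ht => ?_) hint ?_
  · have h1 := Nat.floor_le (div_nonneg ht hn'.le)
    have h2 := Nat.lt_floor_add_one (t / n)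
    rw [le_div_iff₀ hn'] at h1
    rw [div_lt_iff₀ hn'] at h2
    rw [hΔ, sub_sSup_eq ha₀ hd (l := ⌊t / n⌋₊) ⟨h1, by linarith⟩]
    refine add_nonneg (sub_nonneg.2 h1) ?_
    split_ifs
    · exact le_rfl
    · exact hA0 _
  · have hsum : ∀ L : ℕ, ∫ t in (0 : ℝ)..(L * n), Δ t = n * ∑ l ∈ Finset.range L, A l +
        L * ((n : ℝ) ^ 2 / 2) -
        ∑ l ∈ Finset.range L, (if S l then (n : ℝ) - d l else 0) * A l := fun L => by
      have := intervalIntegral.sum_integral_adjacent_intervals (f := Δ) (μ := volume)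
        (a := fun l : ℕ => (l * n : ℝ)) (n := L) fun l _ => (hslot l).1
      simp only [Nat.cast_zero, zero_mul] at this
      rw [← this, Finset.sum_congr rfl fun l _ => (hslot l).2, Finset.sum_sub_distrib,
        Finset.sum_add_distrib, ← Finset.mul_sum]
      simp
    have := ((hα.const_mul (n : ℝ)).add_const ((n : ℝ) ^ 2 / 2)).sub hβ
    refine this.congr' ?_
    filter_upwards [eventually_gt_atTop 0] with L hL
    have hL' : (0 : ℝ) < L := by exact_mod_cast hL
    rw [hsum]
    field_simp

end SamplePath

/-! ### The law of one packet: success probability and mean remaining time. -/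

section Law

variable {F : Type*} [Field F] [Finite F] [MeasurableSpace F] [DiscreteMeasurableSpace F]
  {k n : ℕ}

lemma isProbabilityMeasure_useLaw (hk : 1 ≤ k) (ε : unitInterval) :
    IsProbabilityMeasure (useLaw F k ε) := by
  have : IsProbabilityMeasure (uniformOn {v : Fin k → F | v ≠ 0}) :=
    isProbabilityMeasure_uniformOn (Set.toFinite _)
      ⟨fun _ => 1, fun h => one_ne_zero (congrFun h ⟨0, hk⟩)⟩
  unfold useLaw
  infer_instance

lemma useLaw_singleton_ne_zero {ε : unitInterval} (hε : (ε : ℝ) < 1) {v : Fin k → F}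
    (hv : v ≠ 0) : useLaw F k ε {(v, false)} ≠ 0 := by
  have h1 : uniformOn {v : Fin k → F | v ≠ 0} {v} ≠ 0 := by
    rw [Ne, uniformOn_eq_zero_iff (Set.toFinite _)]
    exact Set.Nonempty.ne_empty ⟨v, hv, rfl⟩
  have h2 : bernoulliMeasure true false ε {false} ≠ 0 := by
    rw [bernoulliMeasure_apply_of_notMem_of_mem _ (by simp) (by simp) (Set.mem_singleton _)]
    rw [ENNReal.coe_ne_zero, ← NNReal.coe_ne_zero, unitInterval.coe_toNNReal,
      unitInterval.coe_symm_eq]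
    exact (sub_pos.2 hε).ne'
  rw [useLaw, ← Set.singleton_prod_singleton, Measure.prod_prod]
  exact mul_ne_zero h1 h2

/-- The indicator that a packet is decoded within its `n` channel uses. -/
noncomputable def successIndicator (y : Fin n → (Fin k → F) × Bool) : ℝ :=
  if B (padUses y) ≤ n then 1 else 0

/-- The time left in the slot of a packet once this packet is decoded, and `0` if it is lost. -/
noncomputable def remainingTime (y : Fin n → (Fin k → F) × Bool) : ℝ :=
  if B (padUses y) ≤ n then (n : ℝ) - ((B (padUses y)).toNat - 1 : ℕ) else 0

lemma map_prefix_packetLaw (hk : 1 ≤ k) (ε : unitInterval) :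
    (packetLaw F k ε).map (fun x (i : Fin n) => x i) =
      Measure.infinitePi fun _ : Fin n => useLaw F k ε := by
  have := isProbabilityMeasure_useLaw (F := F) hk ε
  exact Measure.map_infinitePi_infinitePi_of_inj (P := fun _ : ℕ => useLaw F k ε)
    (Fin.val_injective (n := n))

lemma measurableSet_B_le (n : ℕ) : MeasurableSet {x : ℕ → (Fin k → F) × Bool | B x ≤ n} := by
  have : {x : ℕ → (Fin k → F) × Bool | B x ≤ n} =
      (fun x (i : Fin n) => x i) ⁻¹' {y : Fin n → (Fin k → F) × Bool | B (padUses y) ≤ n} := by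
    ext x
    exact (B_padUses_le_iff x le_rfl).symm
  rw [this]
  exact (by fun_prop : Measurable fun (x : ℕ → (Fin k → F) × Bool) (i : Fin n) => x i)
    (Set.toFinite _).measurableSet

lemma integral_successIndicator (hk : 1 ≤ k) (ε : unitInterval) :
    ∫ y, successIndicator y ∂(Measure.infinitePi fun _ : Fin n => useLaw F k ε) =
      (packetLaw F k ε).real {x | B x ≤ n} := by
  rw [← map_prefix_packetLaw hk, integral_map (Measurable.aemeasurable (by fun_prop)) .of_discrete,
    ← integral_indicator_one (measurableSet_B_le n)]
  congr 1
  ext x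
  simp [successIndicator, B_padUses_le_iff x le_rfl, Set.indicator_apply]

lemma real_B_le_eq (hk : 1 ≤ k) (n : ℕ) (ε : unitInterval) :
    (packetLaw F k ε).real {x | B x ≤ n} = 1 - erasureProb F k n ε := by
  have := isProbabilityMeasure_useLaw (F := F) hk ε
  have : IsProbabilityMeasure (packetLaw F k ε) := by unfold packetLaw; infer_instance
  have h := probReal_compl_eq_one_sub (μ := packetLaw F k ε)
    (measurableSet_B_le (F := F) (k := k) n)
  have e : {x : ℕ → (Fin k → F) × Bool | B x ≤ n}ᶜ = {x | (n : ℕ∞) < B x} := by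
    ext x; simp
  rw [e] at h
  rw [erasureProb, h]; ring

/-- A single prefix of positive mass suffices: no erasures, and the standard basis as the first `k`
columns. -/
lemma real_B_le_pos (hk : 1 ≤ k) (hkn : k ≤ n) {ε : unitInterval} (hε : (ε : ℝ) < 1) :
    0 < (packetLaw F k ε).real {x | B x ≤ n} := by
  have := isProbabilityMeasure_useLaw (F := F) hk ε
  have : IsProbabilityMeasure (packetLaw F k ε) := by unfold packetLaw; infer_instance
  let y₀ : Fin n → (Fin k → F) × Bool := fun i =>
    -- Columns beyond the first `k` need only be nonzero to carry mass.
    (Pi.single (if h : (i : ℕ) < k then ⟨i, h⟩ else ⟨0, hk⟩) 1, false)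
  have hy₀ : B (padUses y₀) ≤ n := by
    rw [B_le_iff, decodable_padUses_iff]
    refine ⟨Fin.castLE hkn, fun j => ⟨(Fin.castLE hkn j).2, rfl⟩, ?_⟩
    have : (fun j : Fin k => (y₀ (Fin.castLE hkn j)).1) = fun j => Pi.single j (1 : F) := by
      ext j : 1
      simp [y₀]
    rw [this]
    exact Pi.linearIndependent_single_one (Fin k) F
  have hpos : (packetLaw F k ε) {x | B x ≤ n} ≠ 0 := by
    refine ne_bot_of_le_ne_bot (b := Measure.infinitePi (fun _ : Fin n => useLaw F k ε) {y₀}) ?_ ?_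
    · rw [Measure.infinitePi_singleton_of_fintype]
      exact Finset.prod_ne_zero_iff.2 fun i _ => useLaw_singleton_ne_zero hε (by simp)
    · rw [← map_prefix_packetLaw hk, Measure.map_apply (by fun_prop) (measurableSet_singleton _)]
      refine measure_mono fun x hx => ?_
      rw [Set.mem_preimage, Set.mem_singleton_iff] at hx
      exact (B_padUses_le_iff x le_rfl).1 (hx ▸ hy₀)
  exact ENNReal.toReal_pos hpos (measure_ne_top _ _)

lemma integral_remainingTime (hk : 1 ≤ k) (hkn : k ≤ n) {ε : unitInterval} (hε : (ε : ℝ) < 1) :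
    ∫ y, remainingTime y ∂(Measure.infinitePi fun _ : Fin n => useLaw F k ε) =
      (packetLaw F k ε).real {x | B x ≤ n} * (n + 1 - meanT F k n ε) := by
  have := isProbabilityMeasure_useLaw (F := F) hk ε
  have : IsProbabilityMeasure (packetLaw F k ε) := by unfold packetLaw; infer_instance
  have hs := measurableSet_B_le (F := F) (k := k) n
  have hp := real_B_le_pos (F := F) hk hkn hε
  set μ := packetLaw F k ε
  set s := {x : ℕ → (Fin k → F) × Bool | B x ≤ n}
  have hX : ∀ x : ℕ → (Fin k → F) × Bool, remainingTime (fun i : Fin n => x i) =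
      s.indicator (fun x => (n : ℝ) + 1 - ((B x).toNat : ℝ)) x := by
    intro x
    by_cases hx : B x ≤ n
    · have h1 : 1 ≤ (B x).toNat := by
        have := ENat.toNat_le_toNat (one_le_B hk x)
          (ne_top_of_le_ne_top (ENat.natCast_ne_top n) hx)
        simpa using this
      have hx' : x ∈ s := hx
      rw [Set.indicator_of_mem hx', remainingTime, B_padUses_eq x hx, if_pos hx, Nat.cast_sub h1]
      push_cast; ring
    · have hx' : x ∉ s := hx
      rw [Set.indicator_of_notMem hx', remainingTime, if_neg]
      rwa [B_padUses_le_iff x le_rfl]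
  -- On `s`, `B` is a function of the first `n` uses, which take finitely many values.
  have hint : IntegrableOn (fun x => ((B x).toNat : ℝ)) s μ := by
    have h0 : IntegrableOn (fun x => ((B (padUses fun i : Fin n => x i)).toNat : ℝ)) s μ := by
      let φ : (Fin n → (Fin k → F) × Bool) → ℝ := fun y => ((B (padUses y)).toNat : ℝ)
      obtain ⟨C, hC⟩ := (Set.finite_range fun y => ‖φ y‖).bddAbove
      have hm : Measurable fun x : ℕ → (Fin k → F) × Bool => φ fun i : Fin n => x i :=
        (Measurable.of_discrete (f := φ)).comp (by fun_prop)
      exact Integrable.of_bound hm.aestronglyMeasurable C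
        (ae_of_all _ fun x => hC ⟨_, rfl⟩)
    exact h0.congr_fun (fun x hx => by simp only [B_padUses_eq x hx]) hs
  have hmean : meanT F k n ε = (μ.real s)⁻¹ * ∫ x in s, ((B x).toNat : ℝ) ∂μ := by
    rw [meanT, ProbabilityTheory.cond, integral_smul_measure, smul_eq_mul, ENNReal.toReal_inv]
    rfl
  rw [← map_prefix_packetLaw hk, integral_map (Measurable.aemeasurable (by fun_prop)) .of_discrete]
  simp_rw [hX]
  rw [integral_indicator hs, integral_sub (integrable_const _) hint, setIntegral_const, hmean,
    smul_eq_mul]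
  field_simp

end Law

end RandomLinearScheme

/-! ### Assembly on the given probability space. -/

open RandomLinearScheme

theorem theorem5 {F : Type*} [Field F] [Finite F] [MeasurableSpace F] [DiscreteMeasurableSpace F]
    {Ω : Type*} [MeasurableSpace Ω] (P : Measure Ω) [IsProbabilityMeasure P]
    (k n : ℕ) (hk : 1 ≤ k) (hkn : k ≤ n) (ε : unitInterval) (hε : (ε : ℝ) < 1)
    (u : ℕ → Ω → Fin k → F)
    (G : ℕ → Ω → Matrix (Fin k) (Fin n) F)
    (e : ℕ → Ω → Fin n → Bool)
    (hindep : iIndepFun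
      (fun (p : ℕ × Fin n) (ω : Ω) => ((fun j : Fin k => G p.1 ω j p.2), e p.1 ω p.2)) P)
    (hlaw : ∀ p : ℕ × Fin n,
      HasLaw (fun ω : Ω => ((fun j : Fin k => G p.1 ω j p.2), e p.1 ω p.2))
        (RandomLinearScheme.useLaw F k ε) P)
    (a₀ : ℝ) (ha₀ : 0 ≤ a₀) :
    ∀ᵐ ω ∂P, RandomLinearScheme.HasAverageAge
      (RandomLinearScheme.age (fun l => G l ω) (fun l => e l ω) (fun m => u m ω) a₀)
      (RandomLinearScheme.meanT F k n ε - 1 +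
        n * (1 + RandomLinearScheme.erasureProb F k n ε) /
          (2 * (1 - RandomLinearScheme.erasureProb F k n ε))) := by
  have hprob := isProbabilityMeasure_useLaw (F := F) hk ε
  have hn : 0 < n := by omega
  have hn' : (0 : ℝ) < n := by exact_mod_cast hn
  have hp := real_B_le_pos (F := F) hk hkn hε
  have hpe := real_B_le_eq (F := F) hk n ε
  have hIm := integral_successIndicator (F := F) (n := n) hk ε
  have hXm := integral_remainingTime (F := F) hk hkn hε
  set p := (packetLaw F k ε).real {x | B x ≤ n}
  set ν : Measure (Fin n → (Fin k → F) × Bool) := Measure.infinitePi fun _ => useLaw F k ε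
  -- The strong laws are proved on the canonical space, where the slots are measurable coordinates,
  -- then pulled back along the joint law; `G` and `e` provide only a.e. measurable pairs.
  set Q : Measure (ℕ → Fin n → (Fin k → F) × Bool) := Measure.infinitePi fun _ => ν
  have hW : ∀ l, Measurable fun w : ℕ → Fin n → (Fin k → F) × Bool => w l := by fun_prop
  have hind : iIndepFun (fun l (w : ℕ → Fin n → (Fin k → F) × Bool) => w l) Q :=
    iIndepFun_infinitePi (X := fun _ y => y) fun _ => measurable_id
  have hmean : ∀ (f : (Fin n → (Fin k → F) × Bool) → ℝ) (l : ℕ),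
      ∫ w, f (w l) ∂Q = ∫ y, f y ∂ν := fun f l => by
    rw [← Measure.infinitePi_map_eval (fun _ : ℕ => ν) l,
      integral_map (Measurable.aemeasurable (by fun_prop)) .of_discrete]
  have hI : ∀ y : Fin n → (Fin k → F) × Bool, successIndicator y = 0 ∨ successIndicator y = 1 :=
    fun y => by unfold successIndicator; split_ifs <;> simp
  have hd : ∀ y : Fin n → (Fin k → F) × Bool, B (padUses y) ≤ n →
      (B (padUses y)).toNat - 1 < n := fun y hy => by
    have := ENat.toNat_le_toNat hy (ENat.natCast_ne_top n)
    rw [ENat.toNat_natCast] at this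
    omega
  have hX0 : ∀ y : Fin n → (Fin k → F) × Bool, 0 ≤ remainingTime y := fun y => by
    unfold remainingTime
    split_ifs with h
    · exact sub_nonneg.2 (by exact_mod_cast (hd y h).le)
    · exact le_rfl
  have hXn : ∀ y : Fin n → (Fin k → F) × Bool, remainingTime y ≤ n := fun y => by
    unfold remainingTime
    split_ifs
    · exact sub_le_self _ (Nat.cast_nonneg _)
    · exact hn'.le
  have h1 := ae_tendsto_average_startAge (n := n) (a₀ := a₀) hW hind .of_discrete hI hn'.le ha₀ hp
    fun l => (hmean _ l).trans hIm
  have h2 := ae_tendsto_average_mul_startAge (n := n) (a₀ := a₀) hW hind .of_discrete hI hn'.le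
    ha₀ hp (fun l => (hmean _ l).trans hIm) .of_discrete hX0 hXn
    fun l => (hmean _ l).trans hXm
  have hV : HasLaw (fun ω (p : ℕ × Fin n) => ((fun j : Fin k => G p.1 ω j p.2), e p.1 ω p.2))
      (Measure.infinitePi fun _ => useLaw F k ε) P :=
    hindep.hasLaw_infinitePi hlaw (aemeasurable_pi_iff.2 fun p => (hlaw p).aemeasurable)
  have hVm := (MeasurableEquiv.curry ℕ (Fin n) ((Fin k → F) × Bool)).measurable.comp_aemeasurable
    hV.aemeasurable
  -- Currying groups the independent uses `(l, i)` into independent slots.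
  have hQ : P.map (MeasurableEquiv.curry ℕ (Fin n) ((Fin k → F) × Bool) ∘
      fun ω (p : ℕ × Fin n) => ((fun j : Fin k => G p.1 ω j p.2), e p.1 ω p.2)) = Q := by
    rw [← AEMeasurable.map_map_of_aemeasurable (by fun_prop) hV.aemeasurable, hV.map_eq]
    exact Measure.infinitePi_map_curry fun _ _ => useLaw F k ε
  have h12 := h1.and h2
  rw [← hQ] at h12
  filter_upwards [ae_of_ae_map hVm h12] with ω hω
  have key := hasAverageAge_of_tendsto
    (S := fun l => B (padUses fun i => ((fun j => G l ω j i), e l ω i)) ≤ n)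
    (d := fun l => (B (padUses fun i => ((fun j => G l ω j i), e l ω i))).toNat - 1)
    (Δ := age (fun l => G l ω) (fun l => e l ω) (fun m => u m ω) a₀) hn ha₀
    (fun l hl => hd _ hl)
    -- By `deliveredBy_iff` the messages drop out of the age.
    (fun t => by simp only [age, freshest, deliveredBy_iff hk]) hω.1 hω.2
  convert key using 1
  have hq : erasureProb F k n ε = 1 - p := by rw [hpe]; ring
  have hp' := hp.ne'
  rw [hq, sub_sub_cancel]
  field_simp
  ring
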